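/- Let $M$ be a smooth manifold (Hausdorff, second countable, finite-dimensional), let $\mathcal{O}_M=C^\infty(M)$ and let $T_{\mathcal{O}_M}=\mathrm{Der}_{\mathbb R}(\mathcal{O}_M)=\mathfrak{X}(M)$. An $L_\infty$-algebroid over $\mathcal{O}_M$ is a non-negatively graded $\mathcal{O}_M$-module $L=\bigoplus_{i\ge 0}L_i$ with graded antisymmetric $\mathbb{R}$-multilinear brackets $[\ ]_k$ ($k\ge 1$) of degree $k-2$ that satisfy the higher Jacobi identities $$\sum_{i+j=k}(-1)^{ij}\sum_{\sigma\in S_{i,j}}\chi(\sigma,v)\left[[v_{\sigma(1)},\ldots,v_{\sigma(i)}]_i,v_{\sigma(i+1)},\ldots,v_{\sigma(k)}\right]_{j+1}=0$$ (sum over $i\ge1$, $j\ge 0$ and over the $(i,j)$-unshuffles $\sigma$, where $v_1\wedge\cdots\wedge v_k=\chi(\sigma,v)\,v_{\sigma(1)}\wedge\cdots\wedge v_{\sigma(k)}$), together with an $\mathcal{O}_M$-linear anchor $\rho\colon L\to T_{\mathcal{O}_M}$ of degree $0$ that is a strict morphism to the Lie algebra $T_{\mathcal{O}_M}$ (placed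 in degree $0$), such that $[v_0,av_1]_2=a[v_0,v_1]_2+\rho(v_0)(a)\,v_1$ and $[v_1,\ldots,av_k]_k=a[v_1,\ldots,v_k]_k$ for $k\neq 2$ and $a\in\mathcal{O}_M$. Let $L_\infty/\mathcal{O}_M$ be the category of $L_\infty$-algebroids over $\mathcal{O}_M$, with morphisms the $\mathcal{O}_M$-linear maps of degree $0$ that preserve all brackets and the anchors. Its weak equivalences are the quasi-isomorphisms with respect to the differentials $[\ ]_1$, its fibrations are the morphisms that are surjective in all positive degrees, and its cofibrations are the morphisms with the left lifting property against all morphisms that are both fibrations and weak equivalences (trivial fibrations). Its initial object is the zero $L_\infty$-algebroid. A singular foliation on $M$ is a locally finitely generated $\mathcal{O}_M$-submodule $\mathcal{F}\subset\mathfrak{X}(M)$ closed under the Lie bracket; it is regarded as an object of $L_\infty/\mathcal{O}_M$ concentrated in degree $0$, with the Lie bracket as its only non-zero bracket and the inclusion as its anchor. Theorem. Every singular foliation $\mathcal{F}$ on $M$ has a cofibrant replacement in $L_\infty/\mathcal{O}_M$: there are an $L_\infty$-algebroid $Q$ over $\mathcal{O}_M$ and a factorization $0\xrightarrow{i}Q\xrightarrow{p}\mathcal{F}$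 in $L_\infty/\mathcal{O}_M$ of the morphism from the initial object, with $i$ a cofibration and $p$ a trivial fibration. -/

import Mathlib

open CategoryTheory CategoryTheory.Limits HomotopicalAlgebra
open scoped Manifold ContDiff

universe u v w

/-- The sign `χ(σ, v)` with `v₁ ∧ ⋯ ∧ vₙ = χ(σ, v) v_{σ(1)} ∧ ⋯ ∧ v_{σ(n)}` in the graded exterior
power, for `v` homogeneous of degrees `d`: each inversion of `σ` contributes the factor
`-(-1)^{|v_{σ(i)}| |v_{σ(j)}|}`. -/
def koszulSign {n : ℕ} (σ : Equiv.Perm (Fin n)) (d : Fin n → ℕ) : ℤ :=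
  ∏ i : Fin n, ∏ j : Fin n,
    if i < j ∧ σ j < σ i then -(-1) ^ (d (σ i) * d (σ j)) else 1

/-- `σ` is an `(i, j)`-unshuffle: `σ(1) < ⋯ < σ(i)` and `σ(i+1) < ⋯ < σ(i+j)`. -/
def IsUnshuffle {i j : ℕ} (σ : Equiv.Perm (Fin (i + j))) : Prop :=
  (∀ a b : Fin i, a < b → σ (Fin.castAdd j a) < σ (Fin.castAdd j b)) ∧
    ∀ a b : Fin j, a < b → σ (Fin.natAdd i a) < σ (Fin.natAdd i b)

instance {i j : ℕ} : DecidablePred (IsUnshuffle (i := i) (j := j)) := fun σ => by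
  unfold IsUnshuffle; infer_instance

/-- `∑_σ χ(σ, v) [[v_{σ(1)}, …, v_{σ(i)}]_i, v_{σ(i+1)}, …, v_{σ(i+j)}]_{j+1}`, the sum over all
`(i, j)`-unshuffles `σ`, for `v` homogeneous of degrees `d`. -/
def unshuffleSum {L : Type w} [AddCommGroup L] (br : (n : ℕ) → (Fin n → L) → L) (i j : ℕ)
    (d : Fin (i + j) → ℕ) (v : Fin (i + j) → L) : L :=
  ∑ σ : Equiv.Perm (Fin (i + j)) with IsUnshuffle σ,
    koszulSign σ d •
      br (j + 1) (Fin.cons (br i fun a => v (σ (Fin.castAdd j a)))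
        fun b => v (σ (Fin.natAdd i b)))

/-- An `L_∞`-algebroid over the commutative `k`-algebra `A` (in degree `0`): an `A`-module `L` with a
grading by the non-negative integers, graded antisymmetric `k`-multilinear brackets `[ ]ₙ` of degree
`n - 2` that satisfy the higher Jacobi identities, and an anchor `ρ : L → T_A = Der_k(A)` that is a
strict morphism to the Lie algebra `T_A` (in degree `0`) and is compatible with the brackets. The
differential is `[ ]₁`; the bracket `[ ]₀` is zero, as it has degree `-2`. -/
structure LInftyAlgebroid (k : Type u) [Field k] (A : Type v) [CommRing A] [Algebra k A] where
  carrier : Type w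
  [addCommGroup : AddCommGroup carrier]
  [moduleBase : Module k carrier]
  [module : Module A carrier]
  [isScalarTower : IsScalarTower k A carrier]
  /-- the homogeneous elements of degree `i` -/
  deg : ℕ → Submodule A carrier
  isInternal : DirectSum.IsInternal deg
  bracket : (n : ℕ) → MultilinearMap k (fun _ : Fin n => carrier) carrier
  bracket_mem : ∀ (n : ℕ) (d : Fin n → ℕ) (v : Fin n → carrier), (∀ i, v i ∈ deg (d i)) →
    ∀ m : ℕ, m + 2 = ∑ i, d i + n → bracket n v ∈ deg m
  /-- components of negative degree are zero -/
  bracket_eq_zero : ∀ (n : ℕ) (d : Fin n → ℕ) (v : Fin n → carrier), (∀ i, v i ∈ deg (d i)) →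
    ∑ i, d i + n < 2 → bracket n v = 0
  bracket_swap : ∀ (n : ℕ) (d : Fin n → ℕ) (v : Fin n → carrier), (∀ i, v i ∈ deg (d i)) →
    ∀ i j : Fin n, (i : ℕ) + 1 = j →
      bracket n v = (-(-1) ^ (d i * d j) : ℤ) • bracket n (v ∘ Equiv.swap i j)
  jacobi : ∀ (n : ℕ) (d : Fin n → ℕ) (v : Fin n → carrier), (∀ i, v i ∈ deg (d i)) →
    ∑ p : Finset.HasAntidiagonal.antidiagonal n, ((-1) ^ (p.1.1 * p.1.2) : ℤ) •
      unshuffleSum (fun m => bracket m) p.1.1 p.1.2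
        (d ∘ Fin.cast (Finset.HasAntidiagonal.mem_antidiagonal.mp p.2))
        (v ∘ Fin.cast (Finset.HasAntidiagonal.mem_antidiagonal.mp p.2)) = 0
  anchor : carrier →ₗ[A] Derivation k A A
  anchor_eq_zero : ∀ i, 0 < i → ∀ v ∈ deg i, anchor v = 0
  anchor_bracket_one : ∀ v, anchor (bracket 1 ![v]) = 0
  anchor_bracket_two : ∀ v₀ v₁, anchor (bracket 2 ![v₀, v₁]) = ⁅anchor v₀, anchor v₁⁆
  bracket_two_smul : ∀ (a : A) (v₀ v₁ : carrier),
    bracket 2 ![v₀, a • v₁] = a • bracket 2 ![v₀, v₁] + anchor v₀ a • v₁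
  /-- the differential and the higher brackets are `A`-linear in the last entry -/
  bracket_smul : ∀ (n : ℕ), n + 1 ≠ 2 → ∀ (a : A) (v : Fin n → carrier) (w : carrier),
    bracket (n + 1) (Fin.snoc (α := fun _ => carrier) v (a • w)) =
      a • bracket (n + 1) (Fin.snoc (α := fun _ => carrier) v w)

namespace LInftyAlgebroid

attribute [instance] addCommGroup moduleBase module isScalarTower

variable {k : Type u} [Field k] {A : Type v} [CommRing A] [Algebra k A]

/-- A (strict) morphism: an `A`-linear map of degree `0` that preserves all brackets and commutes
with the anchors. -/
@[ext]
structure Hom (X Y : LInftyAlgebroid.{u, v, w} k A) where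
  toLin : X.carrier →ₗ[A] Y.carrier
  map_deg : ∀ i, ∀ v ∈ X.deg i, toLin v ∈ Y.deg i
  map_bracket : ∀ (n : ℕ) (v : Fin n → X.carrier),
    toLin (X.bracket n v) = Y.bracket n fun i => toLin (v i)
  anchor_comp : ∀ v, Y.anchor (toLin v) = X.anchor v

/-- The category `L_∞/A`. -/
instance : Category (LInftyAlgebroid.{u, v, w} k A) where
  Hom := Hom
  id X := ⟨LinearMap.id, fun _ _ h => h, fun _ _ => rfl, fun _ => rfl⟩
  comp f g :=
    ⟨g.toLin ∘ₗ f.toLin, fun i v h => g.map_deg i _ (f.map_deg i v h),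
      fun n v => by simp [f.map_bracket, g.map_bracket],
      fun v => by simp [f.anchor_comp, g.anchor_comp]⟩

/-- The differential `[ ]₁ : L → L`, which lowers the degree by one. -/
def diff (X : LInftyAlgebroid.{u, v, w} k A) : X.carrier →ₗ[A] X.carrier where
  toFun x := X.bracket 1 ![x]
  map_add' x y := by
    have e : ∀ z : X.carrier, Function.update (![0] : Fin 1 → X.carrier) 0 z = ![z] := by
      intro z; ext i; fin_cases i; rfl
    have h := (X.bracket 1).map_update_add ![0] 0 x y
    rwa [e, e, e] at h
  map_smul' a x := by
    have h := X.bracket_smul 0 (by norm_num) a ![] x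
    have e : ∀ y : X.carrier, Fin.snoc (α := fun _ => X.carrier) ![] y = ![y] := by
      intro y; ext i; fin_cases i; rfl
    rwa [e, e] at h

theorem Hom.map_diff {X Y : LInftyAlgebroid.{u, v, w} k A} (f : Hom X Y) (x : X.carrier) :
    f.toLin (X.diff x) = Y.diff (f.toLin x) := by
  change f.toLin (X.bracket 1 ![x]) = Y.bracket 1 ![f.toLin x]
  rw [f.map_bracket]
  congr 1
  ext i; fin_cases i; rfl

/-- The cycles of degree `i`. -/
def cycles (X : LInftyAlgebroid.{u, v, w} k A) (i : ℕ) : Submodule A X.carrier :=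
  X.deg i ⊓ LinearMap.ker X.diff

/-- The boundaries of degree `i`. -/
def boundaries (X : LInftyAlgebroid.{u, v, w} k A) (i : ℕ) : Submodule A X.carrier :=
  (X.deg (i + 1)).map X.diff

/-- The homology module `H_i` of the complex underlying an `L_∞`-algebroid. -/
abbrev homology (X : LInftyAlgebroid.{u, v, w} k A) (i : ℕ) : Type w :=
  X.cycles i ⧸ (X.boundaries i).submoduleOf (X.cycles i)

theorem Hom.map_cycles {X Y : LInftyAlgebroid.{u, v, w} k A} (f : Hom X Y) (i : ℕ) :
    ∀ x ∈ X.cycles i, f.toLin x ∈ Y.cycles i := by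
  rintro x ⟨hx, hd⟩
  refine ⟨f.map_deg i x hx, ?_⟩
  change Y.diff (f.toLin x) = 0
  rw [← f.map_diff, LinearMap.mem_ker.mp hd, map_zero]

/-- The map induced on homology in degree `i`. -/
def Hom.homologyMap {X Y : LInftyAlgebroid.{u, v, w} k A} (f : Hom X Y) (i : ℕ) :
    X.homology i →ₗ[A] Y.homology i :=
  Submodule.mapQ _ _ (f.toLin.restrict (f.map_cycles i)) (by
    rintro ⟨x, hx⟩ h
    obtain ⟨y, hy, rfl⟩ := h
    exact ⟨f.toLin y, f.map_deg _ y hy, (f.map_diff y).symm⟩)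

/-- Weak equivalences are the quasi-isomorphisms. -/
instance : CategoryWithWeakEquivalences (LInftyAlgebroid.{u, v, w} k A) where
  weakEquivalences := fun _ _ f => ∀ i, Function.Bijective (Hom.homologyMap f i)

/-- Fibrations are the morphisms that are surjective in all positive degrees. -/
instance : CategoryWithFibrations (LInftyAlgebroid.{u, v, w} k A) where
  fibrations := fun X Y f => ∀ i, 0 < i → ∀ y ∈ Y.deg i, ∃ x ∈ X.deg i, Hom.toLin f x = y

/-- Cofibrations are the morphisms with the left lifting property against trivial fibrations. -/
instance : CategoryWithCofibrations (LInftyAlgebroid.{u, v, w} k A) where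
  cofibrations := (trivialFibrations (LInftyAlgebroid.{u, v, w} k A)).llp

/-- The grading of a module concentrated in degree `0`. -/
def concentrated (A : Type v) [CommRing A] (L : Type w) [AddCommGroup L] [Module A L] (i : ℕ) :
    Submodule A L :=
  if i = 0 then ⊤ else ⊥

theorem isInternal_concentrated (A : Type v) [CommRing A] (L : Type w) [AddCommGroup L]
    [Module A L] : DirectSum.IsInternal (concentrated A L) := by
  refine ⟨?_, fun x => ⟨DirectSum.of (fun i => concentrated A L i) 0
    ⟨x, by simp [concentrated]⟩, DirectSum.coeAddMonoidHom_of _ _ _⟩⟩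
  rw [injective_iff_map_eq_zero]
  intro x hx
  have key : ∀ i, i ≠ 0 → x i = 0 := fun i hi => by
    have h := (x i).2
    simp only [concentrated, if_neg hi, Submodule.mem_bot] at h
    exact Subtype.ext h
  have h0 : x = DirectSum.of (fun i => concentrated A L i) 0 (x 0) := by
    refine DFinsupp.ext fun i => ?_
    by_cases hi : i = 0
    · subst hi
      exact (DirectSum.of_eq_same (β := fun i => concentrated A L i) 0 (x 0)).symm
    · rw [key i hi]
      exact (DirectSum.of_eq_of_ne (β := fun i => concentrated A L i) 0 i (x 0) hi).symm
  rw [h0, DirectSum.coeAddMonoidHom_of] at hx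
  have h1 : x 0 = 0 := Subtype.ext hx
  rw [h0, h1, map_zero]

/-- The zero `L_∞`-algebroid. -/
def zero : LInftyAlgebroid.{u, v, w} k A where
  carrier := PUnit
  deg := concentrated A PUnit
  isInternal := isInternal_concentrated A PUnit
  bracket _ := 0
  bracket_mem _ _ _ _ _ _ := Submodule.zero_mem _
  bracket_eq_zero _ _ _ _ _ := rfl
  bracket_swap _ _ _ _ _ _ _ := rfl
  jacobi _ _ _ _ := rfl
  anchor := 0
  anchor_eq_zero _ _ _ _ := rfl
  anchor_bracket_one _ := rfl
  anchor_bracket_two _ _ := by simp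
  bracket_two_smul _ _ _ := rfl
  bracket_smul _ _ _ _ _ := rfl

/-- The zero `L_∞`-algebroid is an initial object of `L_∞/A`. -/
def zeroIsInitial : IsInitial (zero : LInftyAlgebroid.{u, v, w} k A) :=
  IsInitial.ofUniqueHom
    (fun X => (⟨0, fun _ _ _ => by simp, fun n v => by
      rcases n with _ | n
      · exact (X.bracket_eq_zero 0 (fun _ => 0) _ (fun i => Fin.elim0 i) (by simp)).symm
      · exact ((X.bracket (n + 1)).map_coord_zero 0 rfl).symm,
      fun _ => by simp; rfl⟩ : Hom zero X))
    (fun X m => Hom.ext (LinearMap.ext fun x => (map_zero (Hom.toLin m))))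

instance : HasInitial (LInftyAlgebroid.{u, v, w} k A) :=
  zeroIsInitial.hasInitial

end LInftyAlgebroid

namespace LInftyAlgebroid

variable {k : Type u} [Field k] {A : Type v} [CommRing A] [Algebra k A]

/-- The commutator on an `A`-submodule of `T_A` closed under it, as a bilinear bracket. -/
def lieBracket (F : Submodule A (Derivation k A A)) (hF : ∀ X ∈ F, ∀ Y ∈ F, ⁅X, Y⁆ ∈ F) :
    MultilinearMap k (fun _ : Fin 2 => F) F where
  toFun v := ⟨⁅(v 0 : Derivation k A A), (v 1 : Derivation k A A)⁆,
    hF _ (v 0).2 _ (v 1).2⟩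
  map_update_add' v i x y := by
    fin_cases i <;> ext <;> simp [Function.update, Derivation.commutator_apply]
  map_update_smul' v i c x := by
    fin_cases i <;> ext <;> simp [Function.update, Derivation.commutator_apply, smul_sub]

/-- The brackets of a Lie algebra regarded as an `L_∞`-algebra: only `[ ]₂` is non-zero. -/
def lieBrackets (F : Submodule A (Derivation k A A)) (hF : ∀ X ∈ F, ∀ Y ∈ F, ⁅X, Y⁆ ∈ F) :
    (n : ℕ) → MultilinearMap k (fun _ : Fin n => F) F
  | 2 => lieBracket F hF
  | _ => 0

theorem lieBrackets_of_ne (F : Submodule A (Derivation k A A))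
    (hF : ∀ X ∈ F, ∀ Y ∈ F, ⁅X, Y⁆ ∈ F) (n : ℕ) (hn : n ≠ 2) : lieBrackets F hF n = 0 := by
  match n with
  | 0 => rfl
  | 1 => rfl
  | 2 => exact absurd rfl hn
  | n + 3 => rfl

theorem lieBrackets_jacobi (F : Submodule A (Derivation k A A))
    (hF : ∀ X ∈ F, ∀ Y ∈ F, ⁅X, Y⁆ ∈ F) (n : ℕ) (d : Fin n → ℕ) (v : Fin n → F)
    (hv : ∀ i, v i ∈ concentrated A F (d i)) :
    ∑ p : Finset.HasAntidiagonal.antidiagonal n, ((-1) ^ (p.1.1 * p.1.2) : ℤ) •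
      unshuffleSum (fun m => lieBrackets F hF m) p.1.1 p.1.2
        (d ∘ Fin.cast (Finset.HasAntidiagonal.mem_antidiagonal.mp p.2))
        (v ∘ Fin.cast (Finset.HasAntidiagonal.mem_antidiagonal.mp p.2)) = 0 := by
  refine Finset.sum_eq_zero fun p _ => ?_
  obtain ⟨⟨i, j⟩, hp⟩ := p
  have hij : i + j = n := Finset.HasAntidiagonal.mem_antidiagonal.mp hp
  subst hij
  suffices h : unshuffleSum (fun m => lieBrackets F hF m) i j d v = 0 by
    exact (congrArg _ h).trans (smul_zero _)
  by_cases hi : i = 2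
  swap
  · refine Finset.sum_eq_zero fun σ _ => ?_
    dsimp only
    rw [lieBrackets_of_ne F hF i hi, (lieBrackets F hF (j + 1)).map_coord_zero 0 rfl, smul_zero]
  by_cases hj : j = 1
  swap
  · refine Finset.sum_eq_zero fun σ _ => ?_
    dsimp only
    rw [lieBrackets_of_ne F hF (j + 1) (by omega)]
    exact smul_zero _
  subst hi hj
  have hu : (Finset.univ.filter fun σ : Equiv.Perm (Fin (2 + 1)) => IsUnshuffle σ) =
      {1, Equiv.swap 1 2, finRotate 3} := by decide
  unfold unshuffleSum
  rw [hu, Finset.sum_insert (by decide), Finset.sum_insert (by decide), Finset.sum_singleton]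
  by_cases hd : ∀ i, d i = 0
  · obtain rfl : d = fun _ => 0 := funext hd
    have h1 : koszulSign (1 : Equiv.Perm (Fin 3)) (fun _ => 0) = 1 := by decide
    have h2 : koszulSign (Equiv.swap 1 2 : Equiv.Perm (Fin 3)) (fun _ => 0) = -1 := by decide
    have h3 : koszulSign (finRotate 3) (fun _ => 0) = 1 := by decide
    rw [h1, h2, h3]
    apply Subtype.ext
    change (1 : ℤ) • ⁅⁅(v 0 : Derivation k A A), (v 1 : Derivation k A A)⁆, (v 2 : Derivation k A A)⁆ +
      ((-1 : ℤ) • ⁅⁅(v 0 : Derivation k A A), (v 2 : Derivation k A A)⁆, (v 1 : Derivation k A A)⁆ +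
      (1 : ℤ) • ⁅⁅(v 1 : Derivation k A A), (v 2 : Derivation k A A)⁆, (v 0 : Derivation k A A)⁆) = 0
    ext a
    simp [Derivation.commutator_apply]
    ring
  · push Not at hd
    obtain ⟨a, ha⟩ := hd
    have hz : v a = 0 := by
      have h := hv a
      simpa only [concentrated, if_neg ha, Submodule.mem_bot] using h
    have key : ∀ σ : Equiv.Perm (Fin (2 + 1)), lieBrackets F hF (1 + 1)
        (Fin.cons (lieBrackets F hF 2 fun b => v (σ (Fin.castAdd 1 b)))
          fun b => v (σ (Fin.natAdd 2 b))) = 0 := by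
      intro σ
      apply Subtype.ext
      change ⁅⁅(v (σ 0) : Derivation k A A), (v (σ 1) : Derivation k A A)⁆,
        (v (σ 2) : Derivation k A A)⁆ = 0
      obtain ⟨b, rfl⟩ := σ.surjective a
      fin_cases b <;> simp at hz <;> simp [hz]
    simp only [key, smul_zero, add_zero]

/-- An `A`-submodule of `T_A` closed under the commutator, as an `L_∞`-algebroid in degree `0` whose
only bracket is the commutator and whose anchor is the inclusion. -/
def ofLieSubmodule (F : Submodule A (Derivation k A A)) (hF : ∀ X ∈ F, ∀ Y ∈ F, ⁅X, Y⁆ ∈ F) :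
    LInftyAlgebroid.{u, v, v} k A where
  carrier := F
  deg := concentrated A F
  isInternal := isInternal_concentrated A F
  bracket := lieBrackets F hF
  bracket_mem n d v hv m hm := by
    by_cases hn : n = 2
    · subst hn
      by_cases hm0 : m = 0
      · simp [concentrated, hm0]
      · have hd : ∃ i, d i ≠ 0 := by
          by_contra! h
          simp [h] at hm
          exact hm0 hm
        obtain ⟨i, hi⟩ := hd
        have h := hv i
        simp only [concentrated, if_neg hi, Submodule.mem_bot] at h
        rw [(lieBrackets F hF 2).map_coord_zero i h]
        exact Submodule.zero_mem _
    · rw [lieBrackets_of_ne F hF n hn]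
      exact Submodule.zero_mem _
  bracket_eq_zero n d v hv h := by
    rw [lieBrackets_of_ne F hF n (by omega)]; rfl
  bracket_swap n d v hv i j hij := by
    by_cases hn : n = 2
    · subst hn
      obtain rfl : i = 0 := by omega
      obtain rfl : j = 1 := by omega
      by_cases hd : d 0 = 0
      · apply Subtype.ext
        simp [hd, lieBrackets, lieBracket]
      · have h := hv 0
        simp only [concentrated, if_neg hd, Submodule.mem_bot] at h
        rw [(lieBrackets F hF 2).map_coord_zero 0 h,
          (lieBrackets F hF 2).map_coord_zero 1 (by simpa using h), smul_zero]
    · rw [lieBrackets_of_ne F hF n hn]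
      exact (smul_zero _).symm
  jacobi := lieBrackets_jacobi F hF
  anchor := F.subtype
  anchor_eq_zero i hi v hv := by
    simp only [concentrated, if_neg hi.ne', Submodule.mem_bot] at hv
    simp [hv]
  anchor_bracket_one v := rfl
  anchor_bracket_two v₀ v₁ := rfl
  bracket_two_smul a v₀ v₁ := by
    ext
    simp [lieBrackets, lieBracket, Derivation.commutator_apply]
  bracket_smul n hn a v w := by
    rw [lieBrackets_of_ne F hF (n + 1) hn]
    exact (smul_zero a).symm

end LInftyAlgebroid

/-- A cofibrant replacement of `X`: an object `Q` with a factorization `0 ⟶ Q ⟶ X` of the initial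
arrow into a cofibration followed by a trivial fibration. -/
def IsCofibrantReplacement {C : Type u} [Category.{v} C] [CategoryWithWeakEquivalences C]
    [CategoryWithFibrations C] [CategoryWithCofibrations C] [HasInitial C] (X Q : C) : Prop :=
  ∃ (i : ⊥_ C ⟶ Q) (p : Q ⟶ X),
    i ≫ p = initial.to X ∧ Cofibration i ∧ Fibration p ∧ WeakEquivalence p

/-- A singular foliation on a smooth `n`-manifold `M`: a submodule of the `C^∞(M)`-module
`𝔛(M) = Der(C^∞(M))` of smooth vector fields that is closed under the Lie bracket and locally finitely
generated, i.e. every point has an open neighbourhood `U` on which finitely many elements of the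
submodule generate all the others with coefficients in `C^∞(U)`. -/
structure SingularFoliation (n : ℕ) (M : Type u) [TopologicalSpace M]
    [ChartedSpace (EuclideanSpace ℝ (Fin n)) M] where
  fields : Submodule C^∞⟮𝓡 n, M; ℝ⟯ (Derivation ℝ C^∞⟮𝓡 n, M; ℝ⟯ C^∞⟮𝓡 n, M; ℝ⟯)
  lie_mem : ∀ X ∈ fields, ∀ Y ∈ fields, ⁅X, Y⁆ ∈ fields
  locally_fg : ∀ x : M, ∃ U : Set M, IsOpen U ∧ x ∈ U ∧
    ∃ (r : ℕ) (G : Fin r → Derivation ℝ C^∞⟮𝓡 n, M; ℝ⟯ C^∞⟮𝓡 n, M; ℝ⟯),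
      (∀ i, G i ∈ fields) ∧
      ∀ X ∈ fields, ∃ f : Fin r → M → ℝ,
        (∀ i, ContMDiffOn (𝓡 n) 𝓘(ℝ, ℝ) ∞ (f i) U) ∧
        ∀ (g : C^∞⟮𝓡 n, M; ℝ⟯), ∀ y ∈ U, X g y = ∑ i, f i y * G i g y

/-- A singular foliation as an object of `L_∞/C^∞(M)`. -/
noncomputable def SingularFoliation.toLInftyAlgebroid {n : ℕ} {M : Type u} [TopologicalSpace M]
    [ChartedSpace (EuclideanSpace ℝ (Fin n)) M] (F : SingularFoliation n M) :
    LInftyAlgebroid.{0, u, u} ℝ C^∞⟮𝓡 n, M; ℝ⟯ :=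
  LInftyAlgebroid.ofLieSubmodule F.fields F.lie_mem

/-! A contraction of an algebroid `X` onto `F` is extra structure by maps of sets: a section of the
anchor and a homotopy from the identity to section after anchor. Such a structure makes the anchor
`X → F` a quasi-isomorphism (`Contraction.homologyMap_anchorHom_bijective`). The replacement `Q` is
the initial algebroid with a contraction onto `F`.

It exists because the operations can be written as formal expressions. `free` consists of the
expressions in the algebroid operations, the section and the homotopy, two of them being identified
when they agree in every contracted algebroid. It embeds into the product of all of these and
inherits every identity from there (`JointEmbedding`). The product itself would be too large, but
the expressions form a type in the universe of `A`.

Cofibrancy comes from the fact that contractions lift along trivial fibrations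
(`HasCellLifts.exists_contraction`). No linearity is asked of the section and the homotopy, so their
values can be chosen one element at a time. For a map from `Q` to the base of a trivial fibration,
the fibre product is again trivially fibred over `Q`. It therefore carries a contraction lifting
that of `Q`, and initiality gives a section (`section_freeHom`), that is, the lift. -/

namespace LInftyAlgebroid

variable {k : Type u} [Field k] {A : Type v} [CommRing A] [Algebra k A]

/-! ### Homogeneous components, truncations and the differential -/

/-- The projection of an `L_∞`-algebroid onto its component of degree `i`. -/
noncomputable def proj (X : LInftyAlgebroid.{u, v, w} k A) (i : ℕ) : X.carrier →ₗ[A] X.carrier :=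
  (X.deg i).subtype ∘ₗ DirectSum.component A ℕ (fun i => X.deg i) i ∘ₗ
    (LinearEquiv.ofBijective (DirectSum.coeLinearMap X.deg) X.isInternal).symm.toLinearMap

theorem proj_mem (X : LInftyAlgebroid.{u, v, w} k A) (i : ℕ) (x : X.carrier) :
    X.proj i x ∈ X.deg i :=
  SetLike.coe_mem _

theorem proj_eq (X : LInftyAlgebroid.{u, v, w} k A) {j : ℕ} {x : X.carrier} (hx : x ∈ X.deg j)
    (i : ℕ) : X.proj i x = if i = j then x else 0 := by
  have h : (LinearEquiv.ofBijective (DirectSum.coeLinearMap X.deg) X.isInternal).symm x =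
      DirectSum.lof A ℕ (fun i => X.deg i) j ⟨x, hx⟩ := by
    rw [LinearEquiv.symm_apply_eq]
    exact (DirectSum.coeLinearMap_lof X.deg j ⟨x, hx⟩).symm
  simp only [proj, LinearMap.comp_apply, LinearEquiv.coe_coe, h, DirectSum.component.of]
  split_ifs with h1 h2 h2
  · subst h1; rfl
  · exact absurd h1.symm h2
  · exact absurd h2.symm h1
  · rfl

theorem proj_of_mem (X : LInftyAlgebroid.{u, v, w} k A) {i : ℕ} {x : X.carrier}
    (hx : x ∈ X.deg i) : X.proj i x = x := by
  rw [X.proj_eq hx, if_pos rfl]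

theorem exists_sum_proj (X : LInftyAlgebroid.{u, v, w} k A) (x : X.carrier) :
    ∃ N : ℕ, ∑ i ∈ Finset.range N, X.proj i x = x := by
  obtain ⟨y, rfl⟩ := X.isInternal.2 x
  induction y using DirectSum.induction_on with
  | zero => exact ⟨0, by simp⟩
  | of i y =>
    refine ⟨i + 1, ?_⟩
    rw [DirectSum.coeAddMonoidHom_of]
    simp [X.proj_eq y.2]
  | add y z hy hz =>
    -- Components beyond a valid range vanish, so the ranges for `y` and `z` can both be enlarged to
    -- the maximum.
    have aux : ∀ (x : X.carrier) (N : ℕ), ∑ i ∈ Finset.range N, X.proj i x = x →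
        ∀ j, N ≤ j → X.proj j x = 0 := by
      intro x N h j hj
      rw [← h, map_sum]
      refine Finset.sum_eq_zero fun i hi => ?_
      rw [X.proj_eq (X.proj_mem i x), if_neg]
      have := Finset.mem_range.mp hi
      omega
    obtain ⟨N, hN⟩ := hy
    obtain ⟨N', hN'⟩ := hz
    refine ⟨max N N', ?_⟩
    simp only [map_add, Finset.sum_add_distrib]
    congr 1
    · conv_rhs => rw [← hN]
      refine (Finset.sum_subset (Finset.range_subset_range.2 (le_max_left _ _)) ?_).symm
      intro j _ hj
      exact aux _ N hN j (by simpa using hj)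
    · conv_rhs => rw [← hN']
      refine (Finset.sum_subset (Finset.range_subset_range.2 (le_max_right _ _)) ?_).symm
      intro j _ hj
      exact aux _ N' hN' j (by simpa using hj)

theorem Hom.map_proj {X Y : LInftyAlgebroid.{u, v, w} k A} (f : Hom X Y) (i : ℕ) (x : X.carrier) :
    f.toLin (X.proj i x) = Y.proj i (f.toLin x) := by
  obtain ⟨N, hN⟩ := X.exists_sum_proj x
  rw [← hN]
  simp only [map_sum]
  refine Finset.sum_congr rfl fun j _ => ?_
  rw [X.proj_eq (X.proj_mem j x), Y.proj_eq (f.map_deg j _ (X.proj_mem j x))]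
  split_ifs <;> simp

/-- The sum of the components of degree less than `N`. -/
noncomputable def truncation (X : LInftyAlgebroid.{u, v, w} k A) (N : ℕ) :
    X.carrier →ₗ[A] X.carrier :=
  ∑ i ∈ Finset.range N, X.proj i

theorem truncation_apply (X : LInftyAlgebroid.{u, v, w} k A) (N : ℕ) (x : X.carrier) :
    X.truncation N x = ∑ i ∈ Finset.range N, X.proj i x := by
  simp [truncation]

theorem truncation_of_mem (X : LInftyAlgebroid.{u, v, w} k A) {N i : ℕ} {x : X.carrier}
    (hx : x ∈ X.deg i) (hi : i < N) : X.truncation N x = x := by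
  simp [truncation_apply, X.proj_eq hx, hi]

theorem truncation_mono (X : LInftyAlgebroid.{u, v, w} k A) {N N' : ℕ} (h : N ≤ N')
    {x : X.carrier} (hx : X.truncation N x = x) : X.truncation N' x = x := by
  rw [← hx, truncation_apply X N, map_sum]
  refine Finset.sum_congr rfl fun i hi => ?_
  exact X.truncation_of_mem (X.proj_mem i x) (lt_of_lt_of_le (Finset.mem_range.mp hi) h)

theorem bracket_eq_sum_proj (X : LInftyAlgebroid.{u, v, w} k A) {n : ℕ} {N : Fin n → ℕ}
    {v : Fin n → X.carrier} (hv : ∀ i, X.truncation (N i) (v i) = v i) :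
    X.bracket n v = ∑ r ∈ Fintype.piFinset fun i => Finset.range (N i),
      X.bracket n fun i => X.proj (r i) (v i) := by
  conv_lhs => rw [← funext hv]
  simp only [truncation_apply]
  exact (X.bracket n).map_sum_finset _ _

/-- The bound depends only on `n` and `N`, not on `X`. This gives expressions a degree bound valid
in all algebroids at once. -/
theorem truncation_bracket (X : LInftyAlgebroid.{u, v, w} k A) {n : ℕ} {N : Fin n → ℕ}
    {v : Fin n → X.carrier} (hv : ∀ i, X.truncation (N i) (v i) = v i) :
    X.truncation (∑ i, N i + n) (X.bracket n v) = X.bracket n v := by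
  rw [X.bracket_eq_sum_proj hv, map_sum]
  refine Finset.sum_congr rfl fun r hr => ?_
  have hr' : ∀ i, r i < N i := fun i => Finset.mem_range.mp (Fintype.mem_piFinset.mp hr i)
  have hle : ∑ i, r i ≤ ∑ i, N i := Finset.sum_le_sum fun i _ => (hr' i).le
  -- Below this threshold the bracket has negative degree and vanishes; otherwise its degree `∑ r +
  -- n - 2` is a genuine natural number.
  by_cases hd : ∑ i, r i + n < 2
  · rw [X.bracket_eq_zero n r _ (fun i => X.proj_mem _ _) hd, map_zero]
  · exact X.truncation_of_mem (X.bracket_mem n r _ (fun i => X.proj_mem _ _) (∑ i, r i + n - 2)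
      (by omega)) (by omega)

/-- On homogeneous elements the bracket has degree at least `n - 2 > 0`, where the anchor vanishes;
multilinearity does the rest. -/
theorem anchor_bracket_of_three_le (X : LInftyAlgebroid.{u, v, w} k A) {n : ℕ} (hn : 3 ≤ n)
    (v : Fin n → X.carrier) : X.anchor (X.bracket n v) = 0 := by
  choose N hN using fun i => X.exists_sum_proj (v i)
  rw [X.bracket_eq_sum_proj (N := N) fun i => by rw [truncation_apply, hN], map_sum]
  refine Finset.sum_eq_zero fun r _ => ?_
  exact X.anchor_eq_zero (∑ i, r i + n - 2) (by omega) _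
    (X.bracket_mem n r _ (fun i => X.proj_mem _ _) _ (by omega))

theorem diff_apply (X : LInftyAlgebroid.{u, v, w} k A) (x : X.carrier) :
    X.diff x = X.bracket 1 ![x] := rfl

theorem diff_mem (X : LInftyAlgebroid.{u, v, w} k A) {i : ℕ} {x : X.carrier}
    (hx : x ∈ X.deg (i + 1)) : X.diff x ∈ X.deg i :=
  X.bracket_mem 1 (fun _ => i + 1) _ (fun j => by fin_cases j; exact hx) i (by simp)

theorem diff_of_mem_zero (X : LInftyAlgebroid.{u, v, w} k A) {x : X.carrier}
    (hx : x ∈ X.deg 0) : X.diff x = 0 :=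
  X.bracket_eq_zero 1 (fun _ => 0) _ (fun j => by fin_cases j; exact hx) (by simp)

theorem bracket_zero (X : LInftyAlgebroid.{u, v, w} k A) (v : Fin 0 → X.carrier) :
    X.bracket 0 v = 0 :=
  X.bracket_eq_zero 0 (fun _ => 0) _ (fun i => i.elim0) (by simp)

theorem unshuffleSum_zero_left (X : LInftyAlgebroid.{u, v, w} k A) (j : ℕ) (d : Fin (0 + j) → ℕ)
    (v : Fin (0 + j) → X.carrier) : unshuffleSum (fun m => X.bracket m) 0 j d v = 0 := by
  refine Finset.sum_eq_zero fun σ _ => ?_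
  dsimp only
  rw [(X.bracket (j + 1)).map_coord_zero 0 (by simp [X.bracket_zero]), smul_zero]

theorem unshuffleSum_one_zero (X : LInftyAlgebroid.{u, v, w} k A) (d : Fin (1 + 0) → ℕ)
    (v : Fin (1 + 0) → X.carrier) :
    unshuffleSum (fun m => X.bracket m) 1 0 d v = X.diff (X.diff (v 0)) := by
  have hu : (Finset.univ.filter fun σ : Equiv.Perm (Fin (1 + 0)) => IsUnshuffle σ) = {1} := by
    decide
  have hs : koszulSign (1 : Equiv.Perm (Fin (1 + 0))) d = 1 := by simp [koszulSign]
  rw [unshuffleSum, hu, Finset.sum_singleton, hs, one_smul, diff_apply, diff_apply]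
  congr 1
  ext j; fin_cases j
  change X.bracket 1 _ = X.bracket 1 _
  congr 1
  ext j; fin_cases j; rfl

/-- This is the Jacobi identity for one entry. The sum also contains the split `(0, 1)`, whose inner
bracket `[ ]₀` is zero. -/
theorem diff_diff_of_mem (X : LInftyAlgebroid.{u, v, w} k A) {i : ℕ} {x : X.carrier}
    (hx : x ∈ X.deg i) : X.diff (X.diff x) = 0 := by
  have h := X.jacobi 1 (fun _ => i) ![x] (fun j => by fin_cases j; exact hx)
  rw [Finset.sum_eq_single ⟨(1, 0), by simp⟩] at h
  · have h' := X.unshuffleSum_one_zero (fun _ => i) ![x]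
    have h'' : ((-1) ^ (1 * 0) : ℤ) •
      unshuffleSum (fun m => X.bracket m) 1 0 (fun _ => i) ![x] = 0 := h
    rw [h'] at h''
    simpa using h''
  · rintro ⟨⟨a, b⟩, hp⟩ _ hne
    have hab : a + b = 1 := Finset.HasAntidiagonal.mem_antidiagonal.mp hp
    obtain rfl : a = 0 := by
      by_contra h0
      obtain rfl : a = 1 := by omega
      obtain rfl : b = 0 := by omega
      exact hne rfl
    exact (congrArg _ (X.unshuffleSum_zero_left b _ _)).trans (smul_zero _)
  · intro hn
    exact absurd (Finset.mem_univ _) hn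

/-! ### Algebroid structures detected by a jointly injective family of maps -/

/-- A family of `A`-linear maps `L → X j` that is jointly injective, together with brackets,
homogeneous components and an anchor on `L` that these maps preserve. -/
structure JointEmbedding {ι : Type*} (X : ι → LInftyAlgebroid.{u, v, w} k A) (L : Type w)
    [AddCommGroup L] [Module A L] where
  map : ∀ j, L →ₗ[A] (X j).carrier
  ext : ∀ x y, (∀ j, map j x = map j y) → x = y
  bracket : (n : ℕ) → (Fin n → L) → L
  map_bracket : ∀ j n v, map j (bracket n v) = (X j).bracket n fun i => map j (v i)
  component : ℕ → L → L
  map_component : ∀ j i x, map j (component i x) = (X j).proj i (map j x)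
  exists_truncation : ∀ x, ∃ N, ∀ j, (X j).truncation N (map j x) = map j x
  anchor : L →ₗ[A] Derivation k A A
  anchor_map : ∀ j x, (X j).anchor (map j x) = anchor x

/-- Transports the Jacobi identity: its failure in the source maps to its failure in each target,
which is zero. -/
theorem map_unshuffleSum {L L' : Type*} [AddCommGroup L] [AddCommGroup L'] (f : L →+ L')
    (br : (n : ℕ) → (Fin n → L) → L) (br' : (n : ℕ) → (Fin n → L') → L')
    (h : ∀ n v, f (br n v) = br' n fun i => f (v i)) (i j : ℕ) (d : Fin (i + j) → ℕ)
    (v : Fin (i + j) → L) :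
    f (unshuffleSum br i j d v) = unshuffleSum br' i j d fun a => f (v a) := by
  simp only [unshuffleSum, map_sum, map_zsmul]
  refine Finset.sum_congr rfl fun σ _ => ?_
  rw [h]
  congr 2
  ext a
  refine Fin.cases ?_ (fun a => ?_) a
  · simp [h]
  · simp

namespace JointEmbedding

variable {ι : Type*} {X : ι → LInftyAlgebroid.{u, v, w} k A} {L : Type w}
    [AddCommGroup L] [Module A L]

/-- The elements of `L` with homogeneous images of degree `i`. -/
def deg (E : JointEmbedding X L) (i : ℕ) : Submodule A L :=
  ⨅ j, ((X j).deg i).comap (E.map j)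

theorem mem_deg (E : JointEmbedding X L) {i : ℕ} {x : L} :
    x ∈ E.deg i ↔ ∀ j, E.map j x ∈ (X j).deg i := by
  simp [deg]

theorem component_mem (E : JointEmbedding X L) (i : ℕ) (x : L) : E.component i x ∈ E.deg i :=
  E.mem_deg.2 fun j => by rw [E.map_component]; exact (X j).proj_mem i _

/-- The components of an element are determined by their images. The truncation bound common to all
`j` makes each element a finite sum; without it, products of gradings would give only infinite sums.
-/
theorem isInternal (E : JointEmbedding X L) : DirectSum.IsInternal E.deg := by
  constructor
  · rw [injective_iff_map_eq_zero]
    intro y hy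
    refine DFinsupp.ext fun i => Subtype.ext (E.ext _ _ fun j => ?_)
    have key : ∀ y : DirectSum ℕ fun i => E.deg i,
        E.map j (y i) = (X j).proj i (E.map j (DirectSum.coeAddMonoidHom E.deg y)) := by
      intro y
      induction y using DirectSum.induction_on with
      | zero => simp
      | of m y =>
        rw [DirectSum.coeAddMonoidHom_of, (X j).proj_eq (E.mem_deg.1 y.2 j),
          DirectSum.coe_of_apply]
        by_cases h : m = i
        · simp [h]
        · rw [if_neg h, if_neg (Ne.symm h)]; simp
      | add y z hy hz => simp [hy, hz]
    rw [key, hy]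
    simp
  · intro x
    obtain ⟨N, hN⟩ := E.exists_truncation x
    refine ⟨∑ i ∈ Finset.range N, DirectSum.of (fun i => E.deg i) i
      ⟨E.component i x, E.component_mem i x⟩, E.ext _ _ fun j => ?_⟩
    rw [← hN j, truncation_apply]
    simp [DirectSum.coeAddMonoidHom_of, E.map_component]

variable [Module k L] [IsScalarTower k A L]

/-- The bracket of a joint embedding is multilinear. -/
def bracketMultilinear (E : JointEmbedding X L) (n : ℕ) :
    MultilinearMap k (fun _ : Fin n => L) L where
  toFun := E.bracket n
  map_update_add' v i x y := E.ext _ _ fun j => by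
    have h : ∀ z, (fun a => E.map j (Function.update v i z a)) =
        Function.update (fun a => E.map j (v a)) i (E.map j z) := fun z =>
      funext fun a => Function.apply_update (fun _ => E.map j) v i z a
    simp only [map_add, map_bracket, h, MultilinearMap.map_update_add]
  map_update_smul' v i c x := E.ext _ _ fun j => by
    have h : ∀ z, (fun a => E.map j (Function.update v i z a)) =
        Function.update (fun a => E.map j (v a)) i (E.map j z) := fun z =>
      funext fun a => Function.apply_update (fun _ => E.map j) v i z a
    rw [LinearMap.map_smul_of_tower, map_bracket, map_bracket, h, h, LinearMap.map_smul_of_tower,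
      MultilinearMap.map_update_smul]

/-- The `L_∞`-algebroid structure on the source of a joint embedding. -/
def toLInftyAlgebroid [Nonempty ι] (E : JointEmbedding X L) : LInftyAlgebroid.{u, v, w} k A where
  carrier := L
  deg := E.deg
  isInternal := E.isInternal
  bracket := E.bracketMultilinear
  bracket_mem n d v hv m hm := E.mem_deg.2 fun j => by
    change E.map j (E.bracket n v) ∈ _
    rw [E.map_bracket]
    exact (X j).bracket_mem n d _ (fun i => E.mem_deg.1 (hv i) j) m hm
  bracket_eq_zero n d v hv h := E.ext _ _ fun j => by
    change E.map j (E.bracket n v) = _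
    rw [E.map_bracket, (X j).bracket_eq_zero n d _ (fun i => E.mem_deg.1 (hv i) j) h, map_zero]
  bracket_swap n d v hv a b hab := E.ext _ _ fun j => by
    change E.map j (E.bracket n v) = E.map j (_ • E.bracket n _)
    rw [map_zsmul, E.map_bracket, E.map_bracket,
      (X j).bracket_swap n d _ (fun i => E.mem_deg.1 (hv i) j) a b hab]
    rfl
  jacobi n d v hv := E.ext _ _ fun j => by
    rw [map_zero, ← (X j).jacobi n d _ (fun i => E.mem_deg.1 (hv i) j), map_sum]
    refine Finset.sum_congr rfl fun p _ => ?_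
    rw [map_zsmul]
    congr 1
    exact map_unshuffleSum (E.map j).toAddMonoidHom _ _ (E.map_bracket j) _ _ _ _
  anchor := E.anchor
  anchor_eq_zero i hi v hv := by
    -- The anchor is the same through every map, so identities of anchors can be read off at a
    -- single index.
    obtain ⟨j⟩ := ‹Nonempty ι›
    rw [← E.anchor_map j, (X j).anchor_eq_zero i hi _ (E.mem_deg.1 hv j)]
  anchor_bracket_one v := by
    obtain ⟨j⟩ := ‹Nonempty ι›
    change E.anchor (E.bracket 1 _) = 0
    rw [← E.anchor_map j, E.map_bracket, ← (X j).anchor_bracket_one (E.map j v)]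
    congr 2; ext i; fin_cases i; rfl
  anchor_bracket_two v₀ v₁ := by
    obtain ⟨j⟩ := ‹Nonempty ι›
    change E.anchor (E.bracket 2 _) = _
    rw [← E.anchor_map j, ← E.anchor_map j, ← E.anchor_map j, E.map_bracket,
      ← (X j).anchor_bracket_two]
    congr 2; ext i; fin_cases i <;> rfl
  bracket_two_smul a v₀ v₁ := E.ext _ _ fun j => by
    change E.map j (E.bracket 2 _) = E.map j (a • E.bracket 2 _ + _)
    have h : ∀ x y : L, E.map j (E.bracket 2 ![x, y]) =
        (X j).bracket 2 ![E.map j x, E.map j y] := by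
      intro x y
      rw [E.map_bracket]
      congr 1; ext i; fin_cases i <;> rfl
    rw [h, map_add, map_smul, map_smul, map_smul, h, (X j).bracket_two_smul, E.anchor_map]
  bracket_smul n hn a v x := E.ext _ _ fun j => by
    change E.map j (E.bracket (n + 1) _) = E.map j (a • E.bracket (n + 1) _)
    have h : ∀ y, E.map j (E.bracket (n + 1) (Fin.snoc (α := fun _ => L) v y)) =
        (X j).bracket (n + 1) (Fin.snoc (α := fun _ => (X j).carrier)
          (fun i => E.map j (v i)) (E.map j y)) := by
      intro y
      rw [E.map_bracket]
      congr 1; ext i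
      refine Fin.lastCases ?_ (fun i => ?_) i <;> simp
    rw [h, map_smul, map_smul, h, (X j).bracket_smul n hn]

/-- The maps of a joint embedding are morphisms. -/
def hom [Nonempty ι] (E : JointEmbedding X L) (j : ι) :
    Hom (E.toLInftyAlgebroid (k := k)) (X j) where
  toLin := E.map j
  map_deg _ _ hv := E.mem_deg.1 hv j
  map_bracket n v := E.map_bracket j n v
  anchor_comp v := E.anchor_map j v

end JointEmbedding

/-! ### Contractions onto a submodule of `T_A` -/

/-- A contraction of an `L_∞`-algebroid `X` onto a submodule `F` of `T_A`: a map `sec` of sets that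
splits the anchor `X₀ → F` and maps `htpy i : Xᵢ → Xᵢ₊₁` of sets that form a homotopy between the
identity of `X` and the composite of the anchor with `sec`. -/
structure Contraction (F : Submodule A (Derivation k A A))
    (X : LInftyAlgebroid.{u, v, w} k A) where
  anchor_mem : ∀ x, X.anchor x ∈ F
  sec : F → X.carrier
  sec_mem : ∀ s, sec s ∈ X.deg 0
  sec_zero : sec 0 = 0
  anchor_sec : ∀ s, X.anchor (sec s) = s
  htpy : ℕ → X.carrier → X.carrier
  htpy_mem : ∀ i, ∀ x ∈ X.deg i, htpy i x ∈ X.deg (i + 1)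
  htpy_zero : ∀ i, htpy i 0 = 0
  diff_htpy_zero : ∀ x ∈ X.deg 0, X.diff (htpy 0 x) = x - sec ⟨X.anchor x, anchor_mem x⟩
  diff_htpy_succ : ∀ i, ∀ x ∈ X.deg (i + 1), X.diff (htpy (i + 1) x) = x - htpy i (X.diff x)

theorem mem_ofLieSubmodule_deg_zero (F : Submodule A (Derivation k A A))
    (hF : ∀ X ∈ F, ∀ Y ∈ F, ⁅X, Y⁆ ∈ F) (x : (ofLieSubmodule F hF).carrier) :
    x ∈ (ofLieSubmodule F hF).deg 0 :=
  Submodule.mem_top (R := A) (M := F)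

theorem eq_zero_of_mem_ofLieSubmodule_deg (F : Submodule A (Derivation k A A))
    (hF : ∀ X ∈ F, ∀ Y ∈ F, ⁅X, Y⁆ ∈ F) {i : ℕ} (hi : 0 < i) {x : (ofLieSubmodule F hF).carrier}
    (hx : x ∈ (ofLieSubmodule F hF).deg i) : x = 0 := by
  have h : (ofLieSubmodule F hF).deg i = ⊥ := if_neg hi.ne'
  rw [h] at hx
  exact (Submodule.mem_bot A).mp hx

/-- The anchor, as a morphism to a submodule of `T_A` that contains its image. -/
def anchorHom {F : Submodule A (Derivation k A A)} (hF : ∀ X ∈ F, ∀ Y ∈ F, ⁅X, Y⁆ ∈ F)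
    (X : LInftyAlgebroid.{u, v, v} k A) (hX : ∀ x, X.anchor x ∈ F) :
    Hom X (ofLieSubmodule F hF) where
  toLin := X.anchor.codRestrict F hX
  map_deg i x hx := by
    rcases i.eq_zero_or_pos with rfl | hi
    · exact mem_ofLieSubmodule_deg_zero F hF _
    · have h : X.anchor.codRestrict F hX x = 0 := Subtype.ext (X.anchor_eq_zero i hi x hx)
      exact Set.mem_of_eq_of_mem h (Submodule.zero_mem ((ofLieSubmodule F hF).deg i))
  map_bracket n v := by
    apply Subtype.ext
    change X.anchor (X.bracket n v) =
      (lieBrackets F hF n fun i => X.anchor.codRestrict F hX (v i) : F)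
    match n with
    | 0 => rw [X.bracket_zero, map_zero]; rfl
    | 1 =>
      have h : v = ![v 0] := by ext i; fin_cases i; rfl
      rw [h, X.anchor_bracket_one]; rfl
    | 2 =>
      have h : v = ![v 0, v 1] := by ext i; fin_cases i <;> rfl
      rw [h, X.anchor_bracket_two]; rfl
    | n + 3 => rw [X.anchor_bracket_of_three_le (by omega)]; rfl
  anchor_comp x := rfl

/-- The zero homotopy contracts `F` onto itself. -/
def contractionSelf (F : Submodule A (Derivation k A A)) (hF : ∀ X ∈ F, ∀ Y ∈ F, ⁅X, Y⁆ ∈ F) :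
    Contraction F (ofLieSubmodule F hF) where
  anchor_mem x := x.2
  sec s := s
  sec_mem s := mem_ofLieSubmodule_deg_zero F hF s
  sec_zero := rfl
  anchor_sec s := rfl
  htpy _ _ := 0
  htpy_mem _ _ _ := Submodule.zero_mem _
  htpy_zero _ := rfl
  diff_htpy_zero x _ := by
    rw [map_zero]
    exact (sub_self x).symm
  diff_htpy_succ i x hx := by
    rw [eq_zero_of_mem_ofLieSubmodule_deg F hF i.succ_pos hx, map_zero, sub_zero]

/-! ### Expressions and the initial contracted algebroid -/

/-- Formal expressions in the operations of an `L_∞`-algebroid over `A` with a contraction onto `S`. -/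
inductive Term (A S : Type v) : Type v
  | zero : Term A S
  | add : Term A S → Term A S → Term A S
  | smul : A → Term A S → Term A S
  | bracket : (n : ℕ) → (Fin n → Term A S) → Term A S
  | component : ℕ → Term A S → Term A S
  | sec : S → Term A S
  | htpy : ℕ → Term A S → Term A S

/-- An upper bound for the degrees of the components of an expression. -/
def Term.bound {A S : Type v} : Term A S → ℕ
  | zero => 0
  | add s t => max s.bound t.bound
  | smul _ t => t.bound
  | bracket n v => ∑ i, (v i).bound + n
  | component i _ => i + 1
  | sec _ => 1
  | htpy i _ => i + 2

namespace Contraction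

variable {F : Submodule A (Derivation k A A)}

/-- The value of an expression. -/
noncomputable def eval {X : LInftyAlgebroid.{u, v, w} k A} (C : Contraction F X) :
    Term A F → X.carrier
  | .zero => 0
  | .add s t => C.eval s + C.eval t
  | .smul a t => a • C.eval t
  | .bracket n v => X.bracket n fun i => C.eval (v i)
  | .component i t => X.proj i (C.eval t)
  | .sec s => C.sec s
  -- The homotopy is controlled only on degree `i`. Projecting first makes the value homogeneous of
  -- degree `i + 1` for every `t`.
  | .htpy i t => C.htpy i (X.proj i (C.eval t))

theorem truncation_eval {X : LInftyAlgebroid.{u, v, w} k A} (C : Contraction F X)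
    (t : Term A F) : X.truncation t.bound (C.eval t) = C.eval t := by
  induction t with
  | zero => exact map_zero _
  | add s t hs ht =>
    simp only [eval, Term.bound, map_add]
    rw [X.truncation_mono (le_max_left _ _) hs, X.truncation_mono (le_max_right _ _) ht]
  | smul a t ht => simp only [eval, Term.bound, map_smul, ht]
  | bracket n v hv => exact X.truncation_bracket hv
  | component i t => exact X.truncation_of_mem (X.proj_mem _ _) (Nat.lt_succ_self _)
  | sec s => exact X.truncation_of_mem (C.sec_mem s) Nat.zero_lt_one
  | htpy i t =>
    exact X.truncation_of_mem (C.htpy_mem i _ (X.proj_mem _ _)) (Nat.lt_succ_self _)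

theorem map_eval {X Y : LInftyAlgebroid.{u, v, w} k A} (C : Contraction F X) (D : Contraction F Y)
    (f : Hom X Y) (hsec : ∀ s, f.toLin (C.sec s) = D.sec s)
    (hhtpy : ∀ i, ∀ x ∈ X.deg i, f.toLin (C.htpy i x) = D.htpy i (f.toLin x)) (t : Term A F) :
    f.toLin (C.eval t) = D.eval t := by
  induction t with
  | zero => exact map_zero _
  | add s t hs ht => simp only [eval, map_add, hs, ht]
  | smul a t ht => simp only [eval, map_smul, ht]
  | bracket n v hv => simp only [eval, f.map_bracket, hv]
  | component i t ht => simp only [eval, f.map_proj, ht]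
  | sec s => exact hsec s
  | htpy i t ht => simp only [eval, hhtpy i _ (X.proj_mem _ _), f.map_proj, ht]

/-- The anchor is itself a morphism onto `F` that respects contractions. Hence the anchor of a value
depends on the expression alone, and the quotient has a well-defined anchor. -/
theorem anchor_eval {X : LInftyAlgebroid.{u, v, v} k A} (C : Contraction F X)
    (hF : ∀ X ∈ F, ∀ Y ∈ F, ⁅X, Y⁆ ∈ F) (t : Term A F) :
    X.anchor (C.eval t) = F.subtype ((contractionSelf F hF).eval t) := by
  rw [← C.map_eval (contractionSelf F hF) (anchorHom hF X C.anchor_mem)]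
  · rfl
  · exact fun s => Subtype.ext (C.anchor_sec s)
  · exact fun i x hx => Subtype.ext (X.anchor_eq_zero (i + 1) i.succ_pos _ (C.htpy_mem i x hx))

end Contraction

/-- Expressions are identified if they have the same value for all contractions onto `F`. -/
def termSetoid (F : Submodule A (Derivation k A A)) : Setoid (Term A F) where
  r s t := ∀ (X : LInftyAlgebroid.{u, v, v} k A) (C : Contraction F X), C.eval s = C.eval t
  iseqv := ⟨fun _ _ _ => rfl, fun h X C => (h X C).symm, fun h h' X C => (h X C).trans (h' X C)⟩

/-- The underlying set of the initial `L_∞`-algebroid with a contraction onto `F`. -/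
def FreeContracted (F : Submodule A (Derivation k A A)) : Type v :=
  Quotient (termSetoid F)

namespace FreeContracted

variable {F : Submodule A (Derivation k A A)}

/-- The class of an expression. -/
def mk (t : Term A F) : FreeContracted F := Quotient.mk (termSetoid F) t

/-- An expression that represents a given class. -/
noncomputable def rep (x : FreeContracted F) : Term A F := Quotient.out x

/-- The value of a class of expressions for a contraction onto `F`. -/
noncomputable def value (P : Σ X : LInftyAlgebroid.{u, v, v} k A, Contraction F X)
    (x : FreeContracted F) : P.1.carrier :=
  P.2.eval x.rep

theorem value_mk (P : Σ X : LInftyAlgebroid.{u, v, v} k A, Contraction F X) (t : Term A F) :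
    value P (mk t) = P.2.eval t :=
  Quotient.mk_out (s := termSetoid F) t P.1 P.2

theorem mk_rep (x : FreeContracted F) : mk x.rep = x := Quotient.out_eq x

theorem value_ext {x y : FreeContracted F}
    (h : ∀ P : Σ X : LInftyAlgebroid.{u, v, v} k A, Contraction F X, value P x = value P y) :
    x = y := by
  rw [← mk_rep x, ← mk_rep y]
  exact Quotient.sound fun X C => h ⟨X, C⟩

/-- The embedding into the product of all contracted algebroids, along which the group and module
axioms are pulled back. -/
theorem value_injective : Function.Injective
    fun (x : FreeContracted F) (P : Σ X : LInftyAlgebroid.{u, v, v} k A, Contraction F X) =>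
      value P x :=
  fun _ _ h => value_ext fun P => congrFun h P

/-- The operations use chosen representatives, which is harmless because values do not depend on
them. Expressions have no sign or integer multiples of their own; these are scalars from `A`. -/
noncomputable instance : Zero (FreeContracted F) := ⟨mk .zero⟩
noncomputable instance : Add (FreeContracted F) := ⟨fun x y => mk (.add x.rep y.rep)⟩
noncomputable instance : SMul A (FreeContracted F) := ⟨fun a x => mk (.smul a x.rep)⟩
noncomputable instance : Neg (FreeContracted F) := ⟨fun x => (-1 : A) • x⟩
noncomputable instance : Sub (FreeContracted F) := ⟨fun x y => x + -y⟩
noncomputable instance : SMul ℕ (FreeContracted F) := ⟨fun m x => (m : A) • x⟩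
noncomputable instance : SMul ℤ (FreeContracted F) := ⟨fun m x => (m : A) • x⟩

variable (P : Σ X : LInftyAlgebroid.{u, v, v} k A, Contraction F X)

theorem value_zero : value P (0 : FreeContracted F) = 0 := value_mk P _
theorem value_add (x y : FreeContracted F) : value P (x + y) = value P x + value P y := value_mk P _
theorem value_smul (a : A) (x : FreeContracted F) : value P (a • x) = a • value P x := value_mk P _

theorem value_neg (x : FreeContracted F) : value P (-x) = -value P x :=
  (value_smul P _ x).trans (by simp)

noncomputable instance : AddCommGroup (FreeContracted F) :=
  value_injective.addCommGroup _ (funext fun P => value_zero P)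
    (fun x y => funext fun P => value_add P x y) (fun x => funext fun P => value_neg P x)
    (fun x y => funext fun P =>
      (value_add P x (-y)).trans (by rw [value_neg, ← sub_eq_add_neg]; rfl))
    (fun x m => funext fun P => (value_smul P _ x).trans (Nat.cast_smul_eq_nsmul A m _))
    (fun x m => funext fun P => (value_smul P _ x).trans (Int.cast_smul_eq_zsmul A m _))

/-- The value map as a homomorphism to the product of all contracted `L_∞`-algebroids. -/
noncomputable def valueHom : FreeContracted F →+
    ∀ P : Σ X : LInftyAlgebroid.{u, v, v} k A, Contraction F X, P.1.carrier where
  toFun x P := value P x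
  map_zero' := funext fun P => value_zero P
  map_add' x y := funext fun P => value_add P x y

noncomputable instance : Module A (FreeContracted F) :=
  value_injective.module A valueHom fun a x => funext fun P => value_smul P a x

noncomputable instance : Module k (FreeContracted F) :=
  Module.compHom _ (algebraMap k A)

instance : IsScalarTower k A (FreeContracted F) :=
  IsScalarTower.of_algebraMap_smul fun _ _ => rfl

/-- The value map for a contraction onto `F` as a linear map. -/
noncomputable def valueLin : FreeContracted F →ₗ[A] P.1.carrier where
  toFun := value P
  map_add' := value_add P
  map_smul' := value_smul P

/-- The values of an expression determine its class and are compatible with all operations. -/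
noncomputable def jointEmbedding (hF : ∀ X ∈ F, ∀ Y ∈ F, ⁅X, Y⁆ ∈ F) :
    JointEmbedding (fun P : Σ X : LInftyAlgebroid.{u, v, v} k A, Contraction F X => P.1)
      (FreeContracted F) where
  map := valueLin
  ext _ _ h := value_ext h
  bracket n v := mk (.bracket n fun i => (v i).rep)
  map_bracket P _ _ := value_mk P _
  component i x := mk (.component i x.rep)
  map_component P _ _ := value_mk P _
  exists_truncation x := ⟨x.rep.bound, fun P => P.2.truncation_eval x.rep⟩
  anchor := F.subtype ∘ₗ valueLin ⟨ofLieSubmodule F hF, contractionSelf F hF⟩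
  anchor_map P x := P.2.anchor_eval hF x.rep

end FreeContracted

/-- The initial `L_∞`-algebroid with a contraction onto `F`. -/
noncomputable def free (F : Submodule A (Derivation k A A)) (hF : ∀ X ∈ F, ∀ Y ∈ F, ⁅X, Y⁆ ∈ F) :
    LInftyAlgebroid.{u, v, v} k A :=
  haveI : Nonempty (Σ X : LInftyAlgebroid.{u, v, v} k A, Contraction F X) :=
    ⟨⟨ofLieSubmodule F hF, contractionSelf F hF⟩⟩
  (FreeContracted.jointEmbedding hF).toLInftyAlgebroid

variable {F : Submodule A (Derivation k A A)} (hF : ∀ X ∈ F, ∀ Y ∈ F, ⁅X, Y⁆ ∈ F)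

/-- The value of an expression in the initial contracted `L_∞`-algebroid. -/
def freeMk (t : Term A F) : (free F hF).carrier := FreeContracted.mk t

/-- The homotopy of the initial contracted `L_∞`-algebroid. -/
noncomputable def freeHtpy (i : ℕ) (x : (free F hF).carrier) : (free F hF).carrier :=
  freeMk hF (.htpy i (FreeContracted.rep x))

/-- The morphism from the initial contracted `L_∞`-algebroid to any other one. -/
noncomputable def freeHom {X : LInftyAlgebroid.{u, v, v} k A} (C : Contraction F X) :
    Hom (free F hF) X :=
  haveI : Nonempty (Σ X : LInftyAlgebroid.{u, v, v} k A, Contraction F X) := ⟨⟨X, C⟩⟩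
  (FreeContracted.jointEmbedding hF).hom ⟨X, C⟩

theorem freeHom_freeMk {X : LInftyAlgebroid.{u, v, v} k A} (C : Contraction F X) (t : Term A F) :
    (freeHom hF C).toLin (freeMk hF t) = C.eval t :=
  FreeContracted.value_mk ⟨X, C⟩ t

/-- Reduces each axiom of the contraction on `free` to the same axiom in an arbitrary contracted
algebroid. -/
theorem free_ext {x y : (free F hF).carrier}
    (h : ∀ (X : LInftyAlgebroid.{u, v, v} k A) (C : Contraction F X),
      (freeHom hF C).toLin x = (freeHom hF C).toLin y) : x = y :=
  FreeContracted.value_ext fun P => h P.1 P.2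

theorem mem_free_deg {i : ℕ} {x : (free F hF).carrier}
    (h : ∀ (X : LInftyAlgebroid.{u, v, v} k A) (C : Contraction F X),
      (freeHom hF C).toLin x ∈ X.deg i) : x ∈ (free F hF).deg i :=
  (FreeContracted.jointEmbedding hF).mem_deg.2 fun P => h P.1 P.2

theorem freeHom_htpy {X : LInftyAlgebroid.{u, v, v} k A} (C : Contraction F X) (i : ℕ)
    (x : (free F hF).carrier) :
    (freeHom hF C).toLin (freeHtpy hF i x) =
      C.htpy i (X.proj i ((freeHom hF C).toLin x)) :=
  freeHom_freeMk hF C _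

theorem freeHom_htpy_of_mem {X : LInftyAlgebroid.{u, v, v} k A} (C : Contraction F X) {i : ℕ}
    {x : (free F hF).carrier} (hx : x ∈ (free F hF).deg i) :
    (freeHom hF C).toLin (freeHtpy hF i x) =
      C.htpy i ((freeHom hF C).toLin x) := by
  rw [freeHom_htpy, X.proj_of_mem ((freeHom hF C).map_deg i x hx)]

/-- The contraction of the initial contracted `L_∞`-algebroid. -/
noncomputable def freeContraction : Contraction F (free F hF) where
  anchor_mem x := SetLike.coe_mem _
  sec s := freeMk hF (.sec s)
  sec_mem s := mem_free_deg hF fun X C => by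
    rw [freeHom_freeMk]
    exact C.sec_mem s
  sec_zero := free_ext hF fun X C => by
    rw [freeHom_freeMk, map_zero]
    exact C.sec_zero
  anchor_sec s := congrArg F.subtype (freeHom_freeMk hF (contractionSelf F hF) (.sec s))
  htpy i x := freeHtpy hF i x
  htpy_mem i x hx := mem_free_deg hF fun X C => by
    rw [freeHom_htpy]
    exact C.htpy_mem i _ (X.proj_mem _ _)
  htpy_zero i := free_ext hF fun X C => by
    rw [freeHom_htpy, map_zero, map_zero, C.htpy_zero]
  diff_htpy_zero x hx := free_ext hF fun X C => by
    rw [Hom.map_diff, freeHom_htpy_of_mem hF C hx, map_sub, freeHom_freeMk,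
      C.diff_htpy_zero _ ((freeHom hF C).map_deg 0 x hx)]
    simp only [(freeHom hF C).anchor_comp]
    rfl
  diff_htpy_succ i x hx := free_ext hF fun X C => by
    rw [Hom.map_diff, freeHom_htpy_of_mem hF C hx, map_sub,
      freeHom_htpy_of_mem hF C ((free F hF).diff_mem hx), Hom.map_diff,
      C.diff_htpy_succ i _ ((freeHom hF C).map_deg _ x hx)]

/-- The canonical morphisms respect contractions, so both sides have the same value in each
contracted algebroid. -/
theorem freeContraction_eval (t : Term A F) :
    (freeContraction hF).eval t = freeMk hF t :=
  free_ext hF fun X C => by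
    rw [freeHom_freeMk]
    refine (freeContraction hF).map_eval C (freeHom hF C) (fun s => freeHom_freeMk hF C _) ?_ t
    exact fun i x hx => freeHom_htpy_of_mem hF C hx

/-- A morphism to the initial contracted `L_∞`-algebroid that preserves contractions has a
section. -/
theorem section_freeHom {X : LInftyAlgebroid.{u, v, v} k A} (C : Contraction F X)
    (f : Hom X (free F hF)) (hsec : ∀ s, f.toLin (C.sec s) = (freeContraction hF).sec s)
    (hhtpy : ∀ i, ∀ x ∈ X.deg i,
      f.toLin (C.htpy i x) = (freeContraction hF).htpy i (f.toLin x))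
    (x : (free F hF).carrier) : f.toLin ((freeHom hF C).toLin x) = x := by
  obtain ⟨t, rfl⟩ : ∃ t, freeMk hF t = x := ⟨_, FreeContracted.mk_rep x⟩
  rw [freeHom_freeMk, C.map_eval (freeContraction hF) f hsec hhtpy, freeContraction_eval]

/-! ### Trivial fibrations and the lifting of contractions -/

/-- The lifting property of a morphism that is a surjective quasi-isomorphism: elements of degree
`0` lift, and so does an element of positive degree along any given cycle that lifts its
differential. -/
structure HasCellLifts {X Y : LInftyAlgebroid.{u, v, w} k A} (f : Hom X Y) : Prop where
  exists_lift_zero : ∀ y ∈ Y.deg 0, ∃ x ∈ X.deg 0, f.toLin x = y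
  exists_lift_succ : ∀ i, ∀ x ∈ X.deg i, X.diff x = 0 → ∀ y ∈ Y.deg (i + 1),
    Y.diff y = f.toLin x → ∃ z ∈ X.deg (i + 1), f.toLin z = y ∧ X.diff z = x

theorem Hom.homologyMap_injective_iff {X Y : LInftyAlgebroid.{u, v, w} k A} (f : Hom X Y) (i : ℕ) :
    Function.Injective (f.homologyMap i) ↔ ∀ x ∈ X.cycles i,
      f.toLin x ∈ Y.boundaries i → x ∈ X.boundaries i := by
  rw [injective_iff_map_eq_zero]
  have h1 : ∀ x : X.cycles i, f.homologyMap i (Submodule.Quotient.mk x) = 0 ↔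
      f.toLin x ∈ Y.boundaries i := fun x =>
    Submodule.Quotient.mk_eq_zero _
  constructor
  · intro h x hx hfx
    exact (Submodule.Quotient.mk_eq_zero ((X.boundaries i).submoduleOf (X.cycles i))).1
      (h _ ((h1 ⟨x, hx⟩).2 hfx))
  · intro h x
    obtain ⟨x, rfl⟩ := Submodule.Quotient.mk_surjective _ x
    intro hx
    exact (Submodule.Quotient.mk_eq_zero _).2 (h x x.2 ((h1 x).1 hx))

theorem Hom.homologyMap_surjective_iff {X Y : LInftyAlgebroid.{u, v, w} k A} (f : Hom X Y)
    (i : ℕ) : Function.Surjective (f.homologyMap i) ↔ ∀ y ∈ Y.cycles i,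
      ∃ x ∈ X.cycles i, f.toLin x - y ∈ Y.boundaries i := by
  have h1 : ∀ (x : X.cycles i) (y : Y.cycles i),
      f.homologyMap i (Submodule.Quotient.mk x) = Submodule.Quotient.mk y ↔
        f.toLin x - y ∈ Y.boundaries i := fun x y =>
    Submodule.Quotient.eq _
  constructor
  · intro h y hy
    obtain ⟨x, hx⟩ := h (Submodule.Quotient.mk ⟨y, hy⟩)
    obtain ⟨x, rfl⟩ := Submodule.Quotient.mk_surjective _ x
    exact ⟨x, x.2, (h1 x ⟨y, hy⟩).1 hx⟩
  · intro h y
    obtain ⟨y, rfl⟩ := Submodule.Quotient.mk_surjective _ y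
    obtain ⟨x, hx, hxy⟩ := h y y.2
    exact ⟨Submodule.Quotient.mk ⟨x, hx⟩, (h1 ⟨x, hx⟩ y).2 hxy⟩

/-- Surjectivity on homology and in positive degrees lets cycles lift to cycles. In degree `0` every
element is a cycle, so surjectivity there is automatic. -/
theorem hasCellLifts_of_bijective {X Y : LInftyAlgebroid.{u, v, w} k A} (f : Hom X Y)
    (hf : ∀ i, 0 < i → ∀ y ∈ Y.deg i, ∃ x ∈ X.deg i, f.toLin x = y)
    (hw : ∀ i, Function.Bijective (f.homologyMap i)) : HasCellLifts f := by
  have lift_cycle : ∀ i, ∀ y ∈ Y.cycles i, ∃ x ∈ X.cycles i, f.toLin x = y := by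
    intro i y hy
    obtain ⟨x, hx, z, hz, hxz⟩ := (f.homologyMap_surjective_iff i).1 (hw i).2 y hy
    obtain ⟨t, ht, rfl⟩ := hf _ i.succ_pos z hz
    refine ⟨x - X.diff t, Submodule.sub_mem _ hx ⟨X.diff_mem ht, X.diff_diff_of_mem ht⟩, ?_⟩
    rw [map_sub, f.map_diff, hxz]
    abel
  constructor
  · intro y hy
    obtain ⟨x, hx, rfl⟩ := lift_cycle 0 y ⟨hy, Y.diff_of_mem_zero hy⟩
    exact ⟨x, hx.1, rfl⟩
  · intro i x hx hdx y hy hyx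
    obtain ⟨t, ht, rfl⟩ := (f.homologyMap_injective_iff i).1 (hw i).1 x ⟨hx, hdx⟩ ⟨y, hy, hyx⟩
    -- Injectivity on homology yields some `t` bounding `x`, but `t` need not lift `y`. The error is
    -- a cycle, and lifting it to a cycle corrects `t` without changing its differential.
    obtain ⟨c, hc, hcy⟩ := lift_cycle (i + 1) (y - f.toLin t)
      ⟨Submodule.sub_mem _ hy (f.map_deg _ t ht), LinearMap.mem_ker.2 <| by
        rw [map_sub, hyx, f.map_diff, sub_self]⟩
    refine ⟨t + c, Submodule.add_mem _ ht hc.1, ?_, ?_⟩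
    · rw [map_add, hcy]; abel
    · rw [map_add, LinearMap.mem_ker.1 hc.2, add_zero]

/-- Contractions lift along morphisms with the lifting property of surjective
quasi-isomorphisms. -/
theorem HasCellLifts.exists_contraction {F : Submodule A (Derivation k A A)}
    {X Y : LInftyAlgebroid.{u, v, w} k A} {f : Hom X Y} (hf : HasCellLifts f)
    (D : Contraction F Y) :
    ∃ C : Contraction F X, (∀ s, f.toLin (C.sec s) = D.sec s) ∧
      ∀ i, ∀ x ∈ X.deg i, f.toLin (C.htpy i x) = D.htpy i (f.toLin x) := by
  have anchor_mem : ∀ x, X.anchor x ∈ F := fun x => by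
    rw [← f.anchor_comp]; exact D.anchor_mem _
  have hsec : ∀ s : F, ∃ x ∈ X.deg 0, f.toLin x = D.sec s ∧ (s = 0 → x = 0) := by
    intro s
    by_cases hs : s = 0
    · exact ⟨0, Submodule.zero_mem _, by rw [hs, D.sec_zero, map_zero], fun _ => rfl⟩
    · obtain ⟨x, hx, hxs⟩ := hf.exists_lift_zero _ (D.sec_mem s)
      exact ⟨x, hx, hxs, fun h => absurd h hs⟩
  choose sec sec_mem map_sec sec_zero using hsec
  -- `IsHtpy i h` collects what the construction of the homotopy in degree `i + 1` uses.
  let IsHtpy (i : ℕ) (h : X.carrier → X.carrier) : Prop :=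
    (∀ x ∈ X.deg i, h x ∈ X.deg (i + 1) ∧ f.toLin (h x) = D.htpy i (f.toLin x)) ∧ h 0 = 0 ∧
      ∀ x ∈ X.deg (i + 1), X.diff (h (X.diff x)) = X.diff x
  -- Here `g` is what the homotopy subtracts: section after anchor for `i = 0`, the preceding
  -- homotopy after the differential later. Then `x - g x` is a cycle whose image is bounded by the
  -- given homotopy on `Y`, so a cell lift applies. The vanishing of `g` on boundaries gives `d h d
  -- = d`, the cycle condition for the next degree.
  have exists_htpy : ∀ (i : ℕ) (g : X.carrier → X.carrier), (∀ x ∈ X.deg i, g x ∈ X.deg i) →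
      (∀ x ∈ X.deg i, X.diff (g x) = X.diff x) → g 0 = 0 →
      (∀ x ∈ X.deg i, Y.diff (D.htpy i (f.toLin x)) = f.toLin x - f.toLin (g x)) →
      (∀ x ∈ X.deg (i + 1), g (X.diff x) = 0) →
      ∃ h, IsHtpy i h ∧ ∀ x ∈ X.deg i, X.diff (h x) = x - g x := by
    intro i g hg hdg hg0 hgD hgd
    have key : ∀ x, ∃ z, (x = 0 → z = 0) ∧ (x ∈ X.deg i → z ∈ X.deg (i + 1) ∧
        f.toLin z = D.htpy i (f.toLin x) ∧ X.diff z = x - g x) := by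
      intro x
      by_cases hx0 : x = 0
      · refine ⟨0, fun _ => rfl, fun _ => ⟨Submodule.zero_mem _, ?_, ?_⟩⟩
        · rw [hx0, map_zero, D.htpy_zero]
        · rw [hx0, hg0, map_zero, sub_zero]
      by_cases hx : x ∈ X.deg i
      · obtain ⟨z, hz, h1, h2⟩ := hf.exists_lift_succ i (x - g x) (Submodule.sub_mem _ hx (hg x hx))
          (by rw [map_sub, hdg x hx, sub_self]) (D.htpy i (f.toLin x))
          (D.htpy_mem i _ (f.map_deg i x hx)) (by rw [hgD x hx, map_sub])
        exact ⟨z, fun h => absurd h hx0, fun _ => ⟨hz, h1, h2⟩⟩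
      · exact ⟨0, fun _ => rfl, fun h => absurd h hx⟩
    choose h h0 hh using key
    refine ⟨h, ⟨fun x hx => ⟨(hh x hx).1, (hh x hx).2.1⟩, h0 0 rfl, fun x hx => ?_⟩,
      fun x hx => (hh x hx).2.2⟩
    rw [(hh _ (X.diff_mem hx)).2.2, hgd x hx, sub_zero]
  obtain ⟨h₀, hh₀, diff_h₀⟩ := exists_htpy 0 (fun x => sec ⟨X.anchor x, anchor_mem x⟩)
    (fun x _ => sec_mem _)
    (fun x hx => by rw [X.diff_of_mem_zero (sec_mem _), X.diff_of_mem_zero hx])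
    (sec_zero _ (Subtype.ext (map_zero _)))
    (fun x hx => by
      rw [D.diff_htpy_zero _ (f.map_deg 0 x hx), map_sec]
      simp only [f.anchor_comp])
    -- The normalisation at zero is essential: the anchor kills boundaries, and the nonlinear
    -- section must send the resulting zero to zero.
    (fun x _ => sec_zero _ (Subtype.ext (X.anchor_bracket_one x)))
  have step : ∀ (i : ℕ) (h : {h // IsHtpy i h}), ∃ h' : {h' // IsHtpy (i + 1) h'},
      ∀ x ∈ X.deg (i + 1), X.diff (h'.1 x) = x - h.1 (X.diff x) := by
    rintro i ⟨h, h1, h2, h3⟩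
    obtain ⟨h', hh', hd⟩ := exists_htpy (i + 1) (fun x => h (X.diff x))
      (fun x hx => (h1 _ (X.diff_mem hx)).1) h3 (by simp [h2])
      (fun x hx => by
        rw [D.diff_htpy_succ i _ (f.map_deg _ x hx), (h1 _ (X.diff_mem hx)).2, f.map_diff])
      (fun x hx => by simp only [X.diff_diff_of_mem hx, h2])
    exact ⟨⟨h', hh'⟩, hd⟩
  choose next diff_next using step
  let H : ∀ i, {h // IsHtpy i h} := fun i => Nat.rec ⟨h₀, hh₀⟩ next i
  exact ⟨{ anchor_mem := anchor_mem
           sec := sec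
           sec_mem := sec_mem
           sec_zero := sec_zero 0 rfl
           anchor_sec := fun s => by rw [← f.anchor_comp, map_sec, D.anchor_sec]
           htpy := fun i => (H i).1
           htpy_mem := fun i x hx => ((H i).2.1 x hx).1
           htpy_zero := fun i => (H i).2.2.1
           diff_htpy_zero := diff_h₀
           diff_htpy_succ := fun i => diff_next i (H i) },
    map_sec, fun i x hx => ((H i).2.1 x hx).2⟩

/-! ### Fibre products and base change -/

section Pullback

variable {X Y Z : LInftyAlgebroid.{u, v, w} k A} (f : Hom X Z) (g : Hom Y Z)

/-- The underlying module of the fibre product of `L_∞`-algebroids. -/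
def pullbackModule : Submodule A (X.carrier × Y.carrier) :=
  LinearMap.eqLocus (f.toLin ∘ₗ LinearMap.fst A X.carrier Y.carrier)
    (g.toLin ∘ₗ LinearMap.snd A X.carrier Y.carrier)

/-- The two projections of the fibre product. -/
def pullbackMap : ∀ b : Bool, pullbackModule f g →ₗ[A] (bif b then X else Y).carrier
  | true => LinearMap.fst A X.carrier Y.carrier ∘ₗ (pullbackModule f g).subtype
  | false => LinearMap.snd A X.carrier Y.carrier ∘ₗ (pullbackModule f g).subtype

/-- The operations of the fibre product are computed in the two factors. -/
noncomputable def pullbackEmbedding :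
    JointEmbedding (fun b : Bool => bif b then X else Y) (pullbackModule f g) where
  map := pullbackMap f g
  ext x y h := Subtype.ext (Prod.ext (h true) (h false))
  bracket n v := ⟨(X.bracket n fun i => (v i).1.1, Y.bracket n fun i => (v i).1.2), by
    change f.toLin (X.bracket n _) = g.toLin (Y.bracket n _)
    rw [f.map_bracket, g.map_bracket]
    exact congrArg _ (funext fun i => (v i).2)⟩
  map_bracket b n v := by cases b <;> rfl
  component i x := ⟨(X.proj i x.1.1, Y.proj i x.1.2), by
    change f.toLin (X.proj i _) = g.toLin (Y.proj i _)
    rw [f.map_proj, g.map_proj]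
    exact congrArg _ x.2⟩
  map_component b i x := by cases b <;> rfl
  exists_truncation x := by
    obtain ⟨N, hN⟩ := X.exists_sum_proj x.1.1
    obtain ⟨N', hN'⟩ := Y.exists_sum_proj x.1.2
    rw [← truncation_apply] at hN hN'
    refine ⟨max N N', fun b => ?_⟩
    cases b
    · exact Y.truncation_mono (le_max_right _ _) hN'
    · exact X.truncation_mono (le_max_left _ _) hN
  anchor := X.anchor ∘ₗ pullbackMap f g true
  anchor_map b x := by
    cases b
    · change Y.anchor x.1.2 = X.anchor x.1.1
      rw [← g.anchor_comp, ← f.anchor_comp]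
      exact congrArg _ (Eq.symm x.2)
    · rfl

/-- The fibre product of `L_∞`-algebroids. -/
noncomputable def fiberProduct : LInftyAlgebroid.{u, v, w} k A :=
  (pullbackEmbedding f g).toLInftyAlgebroid

/-- The first projection of the fibre product. -/
noncomputable def fiberProductFst : Hom (fiberProduct f g) X := (pullbackEmbedding f g).hom true

/-- The second projection of the fibre product. -/
noncomputable def fiberProductSnd : Hom (fiberProduct f g) Y := (pullbackEmbedding f g).hom false

theorem fiberProduct_condition (x : (fiberProduct f g).carrier) :
    f.toLin ((fiberProductFst f g).toLin x) = g.toLin ((fiberProductSnd f g).toLin x) :=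
  Subtype.property (p := fun x => x ∈ pullbackModule f g) x

theorem fiberProduct_ext {x y : (fiberProduct f g).carrier}
    (h₁ : (fiberProductFst f g).toLin x = (fiberProductFst f g).toLin y)
    (h₂ : (fiberProductSnd f g).toLin x = (fiberProductSnd f g).toLin y) : x = y :=
  Subtype.ext (p := fun x => x ∈ pullbackModule f g) (Prod.ext h₁ h₂)

theorem exists_fiberProduct {i : ℕ} {x : X.carrier} {y : Y.carrier} (hx : x ∈ X.deg i)
    (hy : y ∈ Y.deg i) (h : f.toLin x = g.toLin y) :
    ∃ z ∈ (fiberProduct f g).deg i, (fiberProductFst f g).toLin z = x ∧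
      (fiberProductSnd f g).toLin z = y :=
  ⟨(⟨(x, y), h⟩ : pullbackModule f g),
    (pullbackEmbedding f g).mem_deg.2 fun b => by cases b; exacts [hy, hx], rfl, rfl⟩

/-- Solve the lifting problem in `Y` with the image of `x` as target, then pair the solution with
`x`. -/
theorem HasCellLifts.fiberProductFst {g : Hom Y Z} (hg : HasCellLifts g) :
    HasCellLifts (fiberProductFst f g) := by
  constructor
  · intro x hx
    obtain ⟨y, hy, hyx⟩ := hg.exists_lift_zero _ (f.map_deg 0 x hx)
    obtain ⟨z, hz, h, -⟩ := exists_fiberProduct f g hx hy hyx.symm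
    exact ⟨z, hz, h⟩
  · intro i p hp hdp x hx hxp
    obtain ⟨y, hy, hyx, hdy⟩ := hg.exists_lift_succ i ((fiberProductSnd f g).toLin p)
      ((fiberProductSnd f g).map_deg i p hp) (by rw [← Hom.map_diff, hdp, map_zero])
      (f.toLin x) (f.map_deg _ x hx) (by rw [← f.map_diff, hxp, fiberProduct_condition])
    obtain ⟨z, hz, h₁, h₂⟩ := exists_fiberProduct f g hx hy hyx.symm
    refine ⟨z, hz, h₁, fiberProduct_ext f g ?_ ?_⟩
    · rw [Hom.map_diff, h₁, hxp]
    · rw [Hom.map_diff, h₂, hdy]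

end Pullback

/-! ### Cofibrancy and the quasi-isomorphism onto the foliation -/

section Replacement

/-- Morphisms from the initial contracted `L_∞`-algebroid lift along surjective
quasi-isomorphisms. -/
theorem exists_lift_free {Y Z : LInftyAlgebroid.{u, v, v} k A} (f : Hom (free F hF) Z)
    {g : Hom Y Z} (hg : HasCellLifts g) :
    ∃ l : Hom (free F hF) Y, ∀ x, g.toLin (l.toLin x) = f.toLin x := by
  obtain ⟨C, hsec, hhtpy⟩ := (hg.fiberProductFst f).exists_contraction (freeContraction hF)
  let l : free F hF ⟶ Y := CategoryStruct.comp (Y := fiberProduct f g)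
    (freeHom hF C) (fiberProductSnd f g)
  refine ⟨l, fun x => ?_⟩
  change g.toLin ((fiberProductSnd f g).toLin ((freeHom hF C).toLin x)) = _
  rw [← fiberProduct_condition, section_freeHom hF C _ hsec hhtpy]

theorem cofibration_initial_to_free :
    Cofibration (initial.to (free F hF)) := by
  rw [cofibration_iff]
  intro Y Z g hg
  constructor
  intro t b sq
  have hw : ∀ i, Function.Bijective (Hom.homologyMap g i) := hg.2
  obtain ⟨l, hl⟩ := exists_lift_free hF b (hasCellLifts_of_bijective g hg.1 hw)
  exact ⟨⟨⟨l, initial.hom_ext _ _, Hom.ext (LinearMap.ext hl)⟩⟩⟩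

/-- The homotopy bounds every cycle of positive degree, and every degree-`0` element with zero
anchor because the section fixes zero. The section gives surjectivity in degree `0`; above it the
target is zero. -/
theorem Contraction.homologyMap_anchorHom_bijective {X : LInftyAlgebroid.{u, v, v} k A}
    (C : Contraction F X) (i : ℕ) :
    Function.Bijective ((anchorHom hF X C.anchor_mem).homologyMap i) := by
  refine ⟨(Hom.homologyMap_injective_iff _ i).2 ?_, (Hom.homologyMap_surjective_iff _ i).2 ?_⟩
  · intro x hx hxb
    refine ⟨C.htpy i x, C.htpy_mem i x hx.1, ?_⟩
    rcases i with _ | i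
    · obtain ⟨y, hy, hyx⟩ := hxb
      rw [eq_zero_of_mem_ofLieSubmodule_deg F hF Nat.one_pos hy, map_zero] at hyx
      have h : (⟨X.anchor x, C.anchor_mem x⟩ : F) = 0 := hyx.symm
      rw [C.diff_htpy_zero x hx.1, h, C.sec_zero, sub_zero]
    · rw [C.diff_htpy_succ i x hx.1, LinearMap.mem_ker.1 hx.2, C.htpy_zero, sub_zero]
  · intro y hy
    rcases i with _ | i
    · refine ⟨C.sec y, ⟨C.sec_mem y, X.diff_of_mem_zero (C.sec_mem y)⟩, ?_⟩
      have h : (anchorHom hF X C.anchor_mem).toLin (C.sec y) = y := Subtype.ext (C.anchor_sec y)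
      rw [h, sub_self]
      exact Submodule.zero_mem _
    · refine ⟨0, Submodule.zero_mem _, ?_⟩
      rw [eq_zero_of_mem_ofLieSubmodule_deg F hF i.succ_pos hy.1, map_zero, sub_zero]
      exact Submodule.zero_mem _

theorem isCofibrantReplacement_free :
    IsCofibrantReplacement (ofLieSubmodule F hF) (free F hF) := by
  refine ⟨initial.to _, anchorHom hF _ (freeContraction hF).anchor_mem, initial.hom_ext _ _,
    cofibration_initial_to_free hF, ⟨?_⟩, ⟨?_⟩⟩
  · intro i hi y hy
    exact ⟨0, Submodule.zero_mem _, by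
      rw [eq_zero_of_mem_ofLieSubmodule_deg F hF hi hy]; exact map_zero _⟩
  · exact (freeContraction hF).homologyMap_anchorHom_bijective hF

end Replacement

end LInftyAlgebroid

theorem theorem4 {n : ℕ} {M : Type u} [TopologicalSpace M] [T2Space M] [SecondCountableTopology M]
    [ChartedSpace (EuclideanSpace ℝ (Fin n)) M] [IsManifold (𝓡 n) ∞ M]
    (F : SingularFoliation n M) :
    ∃ Q : LInftyAlgebroid.{0, u, u} ℝ C^∞⟮𝓡 n, M; ℝ⟯,
      IsCofibrantReplacement F.toLInftyAlgebroid Q :=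
  ⟨_, LInftyAlgebroid.isCofibrantReplacement_free F.lie_mem⟩
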